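/- Call a linear order scattered if it contains no subset order-isomorphic to the chain $\eta=(\mathbb{Q},\le)$ of rational numbers, and let $\mathcal{L}_S(<\omega)$ be the class of posets whose order is the intersection of finitely many scattered linear orders on the same set. Let $T_2$ be the infinite binary tree, that is, the set of finite binary words ordered by "$u$ is a prefix of $v$". Let $\Omega(\eta)$ be the infinite binary tree in which each level is totally ordered from left to right, that is, the set of finite binary words with the least order that contains the prefix order and the lexicographic order on the words of length $n$, for each $n$; equivalently, $u\le v$ if and only if the length of $u$ is at most the length of $v$ and $u$ is at most $v$ lexicographically (a prefix coming first). For a poset $Q$, let the open split $B(\check Q)$ be the set $Q\times\{0,1\}$ ordered by $(x,i)<(y,j)$ if and only if $i<j$ and $x<y$, and let $Q^*$ be the dual of $Q$. A poset embeds in a poset $P$ if it is isomorphic to an induced subposet of $P$. Theorem. If $P\in\mathcal{L}_S(<\omega)$, then none of the posets $$\eta,\quad T_2,\quad \Omega(\eta),\quad B(\check\eta),\quad B(\check T_2),\quad B(\check\Omega(\eta))$$ and none of their duals embeds in $P$. Since $\eta$ and $B(\check\eta)$ are self-dual, this gives exactly ten obstructions: the posets $\eta$, $T_2$, $\Omega(\eta)$,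 $B(\check\eta)$, $B(\check T_2)$, $B(\check\Omega(\eta))$, $T_2^*$, $\Omega(\eta)^*$, $B(\check T_2)^*$, $B(\check\Omega(\eta))^*$ do not belong to $\mathcal{L}_S(<\omega)$ and are pairwise non-isomorphic. -/

import Mathlib

/-- A binary relation `r` (in practice an order) is scattered if no subset is ordered by it as the
chain of the rational numbers. -/
def IsScattered {P : Type*} (r : P → P → Prop) : Prop :=
  IsEmpty ((fun a b : ℚ => a ≤ b) ↪r r)

/-- The class of posets whose order is the intersection of finitely many scattered linear orders
(on the same underlying set). -/
def InLS (P : Type*) [PartialOrder P] : Prop :=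
  ∃ (n : ℕ) (r : Fin n → P → P → Prop),
    (∀ i, IsLinearOrder P (r i)) ∧ (∀ i, IsScattered (r i)) ∧
      ∀ x y : P, x ≤ y ↔ ∀ i, r i x y

/-- The infinite binary tree: the nodes are the finite words over `{false, true}`
(left, right), the root is the empty word, and `u ≤ v` if `u` is a prefix of `v`. -/
@[ext] structure BinTree where
  word : List Bool

instance : PartialOrder BinTree where
  le u v := u.word <+: v.word
  le_refl u := List.prefix_refl u.word
  le_trans _ _ _ h k := List.IsPrefix.trans h k
  le_antisymm _ _ h k := BinTree.ext (h.eq_of_length_le k.length_le)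

/-- The infinite binary tree in which each level is totally ordered from the left to the right:
the nodes are the finite binary words, and `u ≤ v` if the level of `u` is at most the level of `v`
and `u` is at most `v` lexicographically (a prefix comes first). The lemma `OmegaEta.le_iff` below
shows that this is the least order containing the tree order and the left-to-right order of each
level. -/
@[ext] structure OmegaEta where
  word : List Bool

instance : PartialOrder OmegaEta where
  le u v := u.word.length ≤ v.word.length ∧ u.word ≤ v.word
  le_refl u := ⟨le_refl _, le_refl _⟩
  le_trans _ _ _ h k := ⟨h.1.trans k.1, le_trans h.2 k.2⟩
  le_antisymm _ _ h k := OmegaEta.ext (le_antisymm h.2 k.2)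

theorem OmegaEta.le_iff_lex (s t : List Bool) : s ≤ t ↔ List.Lex (· < ·) s t ∨ s = t :=
  le_iff_lt_or_eq

theorem OmegaEta.cons_le_cons (a b : Bool) (s t : List Bool) :
    a :: s ≤ b :: t ↔ a < b ∨ (a = b ∧ s ≤ t) := by
  rw [OmegaEta.le_iff_lex, OmegaEta.le_iff_lex, List.cons.injEq,
    List.cons_lex_cons_iff]
  tauto

theorem OmegaEta.lex_append (s t : List Bool) : s ≤ s ++ t := by
  induction s with
  | nil =>
    rw [OmegaEta.le_iff_lex]
    cases t with
    | nil => exact Or.inr rfl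
    | cons b t => exact Or.inl List.Lex.nil
  | cons a s ih => exact (OmegaEta.cons_le_cons _ _ _ _).2 (Or.inr ⟨rfl, ih⟩)

theorem OmegaEta.exists_prefix (s t : List Bool) (hl : s.length ≤ t.length) (h : s ≤ t) :
    ∃ w, s <+: w ∧ w.length = t.length ∧ w ≤ t := by
  induction s generalizing t with
  | nil => exact ⟨t, List.nil_prefix, rfl, le_refl _⟩
  | cons a s ih =>
    cases t with
    | nil => simp at hl
    | cons b t =>
      simp only [List.length_cons, add_le_add_iff_right] at hl
      rw [OmegaEta.cons_le_cons] at h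
      rcases h with h | ⟨rfl, h⟩
      · refine ⟨a :: (s ++ List.replicate (t.length - s.length) false), ?_, ?_, ?_⟩
        · exact List.cons_prefix_cons.2 ⟨rfl, List.prefix_append _ _⟩
        · simp; omega
        · rw [OmegaEta.cons_le_cons]; exact Or.inl h
      · obtain ⟨w, h1, h2, h3⟩ := ih t hl h
        refine ⟨a :: w, List.cons_prefix_cons.2 ⟨rfl, h1⟩, by simp [h2], ?_⟩
        rw [OmegaEta.cons_le_cons]; exact Or.inr ⟨rfl, h3⟩

theorem OmegaEta.le_iff (u v : OmegaEta) :
    u ≤ v ↔ Relation.ReflTransGen (fun a b : OmegaEta =>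
      a.word <+: b.word ∨ (a.word.length = b.word.length ∧ a.word ≤ b.word)) u v := by
  constructor
  · rintro ⟨hl, h⟩
    obtain ⟨w, h1, h2, h3⟩ := OmegaEta.exists_prefix _ _ hl h
    exact (Relation.ReflTransGen.single (b := OmegaEta.mk w) (Or.inl h1)).tail (Or.inr ⟨h2, h3⟩)
  · intro h
    induction h with
    | refl => exact le_refl _
    | tail _ hs ih =>
      refine ih.trans ?_
      rcases hs with ⟨t, ht⟩ | ⟨h1, h2⟩
      · refine ⟨by rw [← ht]; simp, ?_⟩
        rw [← ht]
        exact OmegaEta.lex_append _ _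
      · exact ⟨h1.le, h2⟩

/-- The open split of a poset `P`: the set `P × {0, 1}` with `(x, i) < (y, j)` if `i < j` and
`x < y`. -/
@[ext] structure OpenSplit (P : Type*) where
  point : P
  side : Fin 2

instance (P : Type*) [PartialOrder P] : PartialOrder (OpenSplit P) where
  le a b := a = b ∨ (a.side < b.side ∧ a.point < b.point)
  lt a b := a.side < b.side ∧ a.point < b.point
  le_refl a := Or.inl rfl
  le_trans a b c := by
    rintro (rfl | h) (rfl | k)
    · exact Or.inl rfl
    · exact Or.inr k
    · exact Or.inr h
    · exact Or.inr ⟨h.1.trans k.1, h.2.trans k.2⟩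
  le_antisymm a b := by
    rintro (rfl | h) (k | k)
    · rfl
    · rfl
    · exact k.symm
    · exact absurd h.1 k.1.asymm
  lt_iff_le_not_ge a b := by
    constructor
    · intro h
      refine ⟨Or.inr h, ?_⟩
      rintro (rfl | k)
      · exact lt_irrefl _ h.1
      · exact h.1.asymm k.1
    · rintro ⟨rfl | h, k⟩
      · exact absurd (Or.inl rfl) k
      · exact h

/-- The ten members of the list. -/
def obstruction : Fin 10 → PartOrd.{0} :=
  ![PartOrd.of ℚ, PartOrd.of BinTree, PartOrd.of OmegaEta,
    PartOrd.of (OpenSplit ℚ), PartOrd.of (OpenSplit BinTree), PartOrd.of (OpenSplit OmegaEta),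
    PartOrd.of BinTreeᵒᵈ, PartOrd.of OmegaEtaᵒᵈ,
    PartOrd.of (OpenSplit BinTree)ᵒᵈ, PartOrd.of (OpenSplit OmegaEta)ᵒᵈ]

/-! Let `≤` on `P` be the intersection of scattered linear orders `r i`, and let `A x ≤ B y`
whenever `x < y`. For each `i`, the elements lying `r i`-below every `B y` with `y > x` form an
initial segment that contains `A x` and grows with `x`. The initial segments of a scattered chain
again form a scattered chain (`exists_strictMono_of_lowerSet`), so these monotone maps cannot
separate points everywhere. On a tree, some node `u` has the property that the segment of any `x ≥
u` is contained in that of some `y` above any given `w ≥ u`; on the rationals, some `u < v` have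
equal segments. Both survive treating the finitely many `r i` one after another, and they force a
comparability `A x ≤ B z` that no obstruction has: from `u1` to some word beginning with `u0`, or
from a rational to a smaller one. For an unsplit poset `A = B` is the embedding; for an open split
they are its restrictions to the two sides. The Ω cases use only the prefix order on words. Duals
follow since the class is closed under duality. Non-isomorphism comes from four order invariants. -/

/-! ### Binary words in in-order -/

/-- The dyadic number in `(0, 1)` coded by a word; the empty word codes `1 / 2`. -/
def dyadic : List Bool → ℚ
  | [] => 1 / 2
  | b :: s => ((if b then 1 else 0) + dyadic s) / 2

theorem dyadic_pos_lt_one (s : List Bool) : 0 < dyadic s ∧ dyadic s < 1 := by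
  induction s with
  | nil => norm_num [dyadic]
  | cons b s ih => cases b <;> simp only [dyadic] <;> constructor <;> norm_num <;> linarith

theorem dyadic_cons_lt_cons (b : Bool) (s t : List Bool) :
    dyadic (b :: s) < dyadic (b :: t) ↔ dyadic s < dyadic t := by
  simp only [dyadic]
  constructor <;> intro h <;> linarith

theorem dyadic_false_lt_true (s t : List Bool) : dyadic (false :: s) < dyadic (true :: t) := by
  have hs := dyadic_pos_lt_one s
  have ht := dyadic_pos_lt_one t
  simp only [dyadic]
  norm_num
  linarith

theorem dyadic_false_lt_nil (s : List Bool) : dyadic (false :: s) < dyadic [] := by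
  have hs := dyadic_pos_lt_one s
  simp only [dyadic]
  norm_num
  linarith

theorem dyadic_nil_lt_true (s : List Bool) : dyadic [] < dyadic (true :: s) := by
  have hs := dyadic_pos_lt_one s
  simp only [dyadic]
  norm_num
  linarith

theorem exists_dyadic_lt (s : List Bool) : ∃ t, dyadic t < dyadic s := by
  induction s with
  | nil => exact ⟨[false], dyadic_false_lt_nil _⟩
  | cons b s ih =>
    obtain ⟨t, ht⟩ := ih
    exact ⟨b :: t, (dyadic_cons_lt_cons _ _ _).2 ht⟩

theorem exists_lt_dyadic (s : List Bool) : ∃ t, dyadic s < dyadic t := by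
  induction s with
  | nil => exact ⟨[true], dyadic_nil_lt_true _⟩
  | cons b s ih =>
    obtain ⟨t, ht⟩ := ih
    exact ⟨b :: t, (dyadic_cons_lt_cons _ _ _).2 ht⟩

theorem exists_dyadic_between (s t : List Bool) (h : dyadic s < dyadic t) :
    ∃ r, dyadic s < dyadic r ∧ dyadic r < dyadic t := by
  induction s generalizing t with
  | nil =>
    match t with
    | [] => exact absurd h (lt_irrefl _)
    | false :: t => exact absurd h (dyadic_false_lt_nil t).asymm
    | true :: t =>
      obtain ⟨r, hr⟩ := exists_dyadic_lt t
      exact ⟨true :: r, dyadic_nil_lt_true _, (dyadic_cons_lt_cons _ _ _).2 hr⟩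
  | cons b s ih =>
    match b, t with
    | true, [] => exact absurd h (dyadic_nil_lt_true s).asymm
    | false, [] =>
      obtain ⟨r, hr⟩ := exists_lt_dyadic s
      exact ⟨false :: r, (dyadic_cons_lt_cons _ _ _).2 hr, dyadic_false_lt_nil _⟩
    | false, true :: t => exact ⟨[], dyadic_false_lt_nil _, dyadic_nil_lt_true _⟩
    | true, false :: t => exact absurd h (dyadic_false_lt_true _ _).asymm
    | false, false :: t =>
      obtain ⟨r, h1, h2⟩ := ih t ((dyadic_cons_lt_cons _ _ _).1 h)
      exact ⟨false :: r, (dyadic_cons_lt_cons _ _ _).2 h1, (dyadic_cons_lt_cons _ _ _).2 h2⟩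
    | true, true :: t =>
      obtain ⟨r, h1, h2⟩ := ih t ((dyadic_cons_lt_cons _ _ _).1 h)
      exact ⟨true :: r, (dyadic_cons_lt_cons _ _ _).2 h1, (dyadic_cons_lt_cons _ _ _).2 h2⟩

/-- Words, compared through their dyadic numbers, contain a copy of the rationals. -/
theorem exists_words_strictMono : ∃ w : ℚ → List Bool, StrictMono fun q => dyadic (w q) := by
  have : DenselyOrdered (Set.range dyadic) := by
    constructor
    rintro ⟨_, s, rfl⟩ ⟨_, t, rfl⟩ h
    obtain ⟨r, h1, h2⟩ := exists_dyadic_between s t h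
    exact ⟨⟨_, r, rfl⟩, h1, h2⟩
  have : Nontrivial (Set.range dyadic) :=
    ⟨⟨_, [], rfl⟩, ⟨_, [true], rfl⟩, fun h =>
      (dyadic_nil_lt_true []).ne (congrArg Subtype.val h)⟩
  obtain ⟨e⟩ := Order.embedding_from_countable_to_dense ℚ (Set.range dyadic)
  choose w hw using fun q => (e q).2
  refine ⟨w, fun a b hab => ?_⟩
  simp only [hw]
  exact e.strictMono hab

/-! ### Copies of the rationals in chains -/

/-- The node reached from `u` by following a word with the left and right successor maps `l`, `r`
and stepping finally to `m`. -/
def splitNode {X : Type*} (l m r : X → X) : List Bool → X → X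
  | [], u => m u
  | b :: s, u => splitNode l m r s (if b then r u else l u)

theorem le_splitNode {X : Type*} [Preorder X] {l m r : X → X} (hl : ∀ u, u ≤ l u)
    (hm : ∀ u, u ≤ m u) (hr : ∀ u, u ≤ r u) (s : List Bool) (u : X) :
    u ≤ splitNode l m r s u := by
  induction s generalizing u with
  | nil => exact hm u
  | cons b s ih =>
    cases b
    · exact (hl u).trans (ih _)
    · exact (hr u).trans (ih _)

/-- The values follow the in-order: where two words part, a left turn stays above `l u`, hence has
value below that of `m u`, and a right turn stays above `r u`, hence has value beyond it. -/
theorem splitNode_lt {X α : Type*} [Preorder X] [Preorder α] {g : X → α} {l m r : X → X}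
    (hl : ∀ u, u ≤ l u) (hm : ∀ u, u ≤ m u) (hr : ∀ u, u ≤ r u)
    (hlm : ∀ u, ∀ y ≥ l u, g y < g (m u)) (hmr : ∀ u, ∀ y ≥ r u, g (m u) < g y)
    (s t : List Bool) (u : X) (h : dyadic s < dyadic t) :
    g (splitNode l m r s u) < g (splitNode l m r t u) := by
  have hn := le_splitNode hl hm hr
  induction s generalizing t u with
  | nil =>
    match t with
    | [] => exact absurd h (lt_irrefl _)
    | false :: t => exact absurd h (dyadic_false_lt_nil t).asymm
    | true :: t => exact hmr u _ (hn t _)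
  | cons b s ih =>
    match b, t with
    | true, [] => exact absurd h (dyadic_nil_lt_true s).asymm
    | false, [] => exact hlm u _ (hn s _)
    | false, true :: t => exact (hlm u _ (hn s _)).trans (hmr u _ (hn t _))
    | true, false :: t => exact absurd h (dyadic_false_lt_true _ _).asymm
    | false, false :: t => exact ih t _ ((dyadic_cons_lt_cons _ _ _).1 h)
    | true, true :: t => exact ih t _ ((dyadic_cons_lt_cons _ _ _).1 h)

/-- If above each node the values of a monotone map on some cone stay below its value at some other
node, then the chain of values contains a copy of the rationals. -/
theorem exists_strictMono_of_splitting {X α : Type*} [Preorder X] [Nonempty X] [LinearOrder α]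
    {g : X → α} (hg : Monotone g)
    (h : ∀ u, ∃ w ≥ u, ∃ x ≥ u, ∀ y ≥ w, g y < g x) : ∃ f : ℚ → α, StrictMono f := by
  choose l hl x hx hlx using h
  obtain ⟨v⟩ := ‹Nonempty X›
  obtain ⟨w, hw⟩ := exists_words_strictMono
  -- The hypothesis separates only two directions at a node. Using it at `u` and again at `x u`
  -- gives three: left `l u`, middle `l (x u)`, right `x (x u)`.
  refine ⟨fun q => g (splitNode l (fun u => l (x u)) (fun u => x (x u)) (w q) v),
    fun a b hab => ?_⟩
  refine splitNode_lt hl (fun u => (hx u).trans (hl _)) (fun u => (hx u).trans (hx _)) ?_ ?_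
    _ _ v (hw hab)
  · exact fun u y hy => (hlx u y hy).trans_le (hg (hl (x u)))
  · exact fun u y hy => (hlx (x u) _ le_rfl).trans_le (hg hy)

/-- The chain of lower sets of a chain without a copy of the rationals contains no such copy. -/
theorem exists_strictMono_of_lowerSet {α : Type*} [LinearOrder α] {I : ℚ → LowerSet α}
    (hI : StrictMono I) : ∃ f : ℚ → α, StrictMono f := by
  -- Doubling each rational gives disjoint gaps `I (q, true) \ I (q, false)`; a point chosen in each
  -- gap yields the copy.
  have : Countable (ℚ ×ₗ Bool) := inferInstanceAs (Countable (ℚ × Bool))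
  obtain ⟨e⟩ := Order.embedding_from_countable_to_dense (ℚ ×ₗ Bool) ℚ
  have hlt (q : ℚ) : I (e (toLex (q, false))) < I (e (toLex (q, true))) :=
    hI (e.strictMono (Prod.Lex.toLex_lt_toLex.2 (Or.inr ⟨rfl, Bool.false_lt_true⟩)))
  choose z hz hz' using fun q => Set.exists_of_ssubset (LowerSet.coe_ssubset_coe.2 (hlt q))
  refine ⟨z, fun a b hab => ?_⟩
  by_contra hba
  refine hz' b ((I _).lower (not_lt.1 hba) (?_ : z a ∈ I _))
  exact (hI (e.strictMono (Prod.Lex.toLex_lt_toLex.2 (Or.inl hab)))).le (hz a)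

/-- A linear order given by a relation, as a `LinearOrder`. -/
noncomputable abbrev linearOrderOfRel {P : Type*} (r : P → P → Prop) [IsLinearOrder P r] :
    LinearOrder P where
  le := r
  le_refl := refl_of r
  le_trans _ _ _ := trans_of r
  le_antisymm _ _ := antisymm_of r
  le_total := total_of r
  toDecidableLE := Classical.decRel _

theorem IsScattered.not_strictMono {P : Type*} {r : P → P → Prop} [IsLinearOrder P r]
    (hr : IsScattered r) (f : ℚ → P) :
    ¬ @StrictMono ℚ P _ (linearOrderOfRel r).toPreorder f := by
  let := linearOrderOfRel r
  intro hf
  exact hr.elim ⟨⟨f, hf.injective⟩, hf.le_iff_le⟩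

/-! ### Initial segments in scattered orders -/

/-- The elements that are below `B y` for every `y` strictly above `x`. -/
def boundsAbove {X P : Type*} [Preorder X] (r : P → P → Prop) (B : X → P) (x : X) : Set P :=
  {z | ∀ y, x < y → r z (B y)}

theorem boundsAbove_mono {X P : Type*} [Preorder X] (r : P → P → Prop) (B : X → P) :
    Monotone (boundsAbove r B) :=
  fun _ _ h _ hz y hy => hz y (h.trans_lt hy)

theorem exists_lowerSet_boundsAbove {X P : Type*} [Preorder X] (r : P → P → Prop)
    [IsLinearOrder P r] (B : X → P) :
    letI := linearOrderOfRel r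
    ∃ g : X → LowerSet P, Monotone g ∧ ∀ x, (g x : Set P) = boundsAbove r B x :=
  letI := linearOrderOfRel r
  ⟨fun x => ⟨boundsAbove r B x, fun _ _ hba ha y hy => le_trans hba (ha y hy)⟩,
    fun _ _ h => boundsAbove_mono r B h, fun _ => rfl⟩

/-- Otherwise every node above `u₀` splits in the sense of `exists_strictMono_of_splitting`, applied
to the cone of `u₀` with values in the chain of lower sets of `r`. -/
theorem exists_cofinal_boundsAbove {X P : Type*} [Preorder X] {r : P → P → Prop}
    [IsLinearOrder P r] (hr : IsScattered r) (B : X → P) (u₀ : X) :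
    ∃ u ≥ u₀, ∀ w ≥ u, ∀ x ≥ u, ∃ y ≥ w, boundsAbove r B x ⊆ boundsAbove r B y := by
  let := linearOrderOfRel r
  by_contra! H
  obtain ⟨g, hg, hgB⟩ := exists_lowerSet_boundsAbove r B
  have : Nonempty (Set.Ici u₀) := ⟨⟨u₀, le_rfl⟩⟩
  obtain ⟨I, hI⟩ := exists_strictMono_of_splitting (X := Set.Ici u₀) (g := fun x => g x)
    (fun _ _ h => hg h) (by
      rintro ⟨u, hu⟩
      obtain ⟨w, hw, x, hx, hwx⟩ := H u hu
      refine ⟨⟨w, le_trans hu hw⟩, hw, ⟨x, le_trans hu hx⟩, hx, fun y hy => ?_⟩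
      rw [← not_le, ← LowerSet.coe_subset_coe, hgB, hgB]
      exact hwx y hy)
  obtain ⟨f, hf⟩ := exists_strictMono_of_lowerSet hI
  exact hr.not_strictMono f hf

/-- The property passes to every node above `u`, so the orders can be treated in turn. One `y`
serves them all because moving it up only enlarges its segments. -/
theorem exists_cofinal_boundsAbove_family {X P ι : Type*} [Preorder X] [Nonempty X]
    (s : Finset ι) (r : ι → P → P → Prop) [∀ i, IsLinearOrder P (r i)]
    (hr : ∀ i, IsScattered (r i)) (B : X → P) :
    ∃ u, ∀ w ≥ u, ∀ x ≥ u, ∃ y ≥ w, ∀ i ∈ s, boundsAbove (r i) B x ⊆ boundsAbove (r i) B y := by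
  classical
  induction s using Finset.induction_on with
  | empty =>
    obtain ⟨u⟩ := ‹Nonempty X›
    exact ⟨u, fun w _ _ _ => ⟨w, le_rfl, by simp⟩⟩
  | insert a s _ ih =>
    obtain ⟨u₀, h₀⟩ := ih
    obtain ⟨u, hu, h⟩ := exists_cofinal_boundsAbove (hr a) B u₀
    refine ⟨u, fun w hw x hx => ?_⟩
    obtain ⟨y, hy, hxy⟩ := h w hw x hx
    obtain ⟨y', hy', hxy'⟩ := h₀ y ((hu.trans hw).trans hy) x (hu.trans hx)
    refine ⟨y', hy.trans hy', fun i hi => ?_⟩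
    rcases Finset.mem_insert.1 hi with rfl | hi
    · exact hxy.trans (boundsAbove_mono _ B hy')
    · exact hxy' i hi

/-- Otherwise the segments strictly increase along `[a, b]`, which contains a copy of the rationals.
-/
theorem exists_boundsAbove_eq {P : Type*} {r : P → P → Prop} [IsLinearOrder P r]
    (hr : IsScattered r) (B : ℚ → P) {a b : ℚ} (hab : a < b) :
    ∃ u v, a ≤ u ∧ u < v ∧ v ≤ b ∧ boundsAbove r B v ⊆ boundsAbove r B u := by
  let := linearOrderOfRel r
  by_contra! H
  obtain ⟨g, hg, hgB⟩ := exists_lowerSet_boundsAbove r B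
  have : Nontrivial (Set.Icc a b) :=
    ⟨⟨a, le_rfl, hab.le⟩, ⟨b, hab.le, le_rfl⟩, fun h => hab.ne (congrArg Subtype.val h)⟩
  obtain ⟨e⟩ := Order.embedding_from_countable_to_dense ℚ (Set.Icc a b)
  obtain ⟨f, hf⟩ := exists_strictMono_of_lowerSet (I := fun q => g (e q)) (fun p q hpq => by
    rw [← not_le, ← LowerSet.coe_subset_coe, hgB, hgB]
    exact H _ _ (e p).2.1 (e.strictMono hpq) (e q).2.2)
  exact hr.not_strictMono f hf

/-- The interval shrinks once per order; by monotonicity, a segment constant between the endpoints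
of an interval stays so on subintervals. -/
theorem exists_boundsAbove_eq_family {P ι : Type*} (s : Finset ι) (r : ι → P → P → Prop)
    [∀ i, IsLinearOrder P (r i)] (hr : ∀ i, IsScattered (r i)) (B : ℚ → P) :
    ∃ u v, u < v ∧ ∀ i ∈ s, boundsAbove (r i) B v ⊆ boundsAbove (r i) B u := by
  classical
  induction s using Finset.induction_on with
  | empty => exact ⟨0, 1, one_pos, by simp⟩
  | insert a s _ ih =>
    obtain ⟨u₀, v₀, h₀, h⟩ := ih
    obtain ⟨u, v, hu, huv, hv, hs⟩ := exists_boundsAbove_eq (hr a) B h₀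
    refine ⟨u, v, huv, fun i hi => ?_⟩
    rcases Finset.mem_insert.1 hi with rfl | hi
    · exact hs
    · exact ((boundsAbove_mono _ B hv).trans (h i hi)).trans (boundsAbove_mono _ B hu)

/-! ### Forced comparabilities in the class -/

/-- Two maps `A`, `B` from a preorder with `A x ≤ B y` for `x < y` have, in a poset of the class,
many further comparabilities. -/
theorem InLS.exists_cofinal {X P : Type*} [Preorder X] [Nonempty X] [PartialOrder P]
    (hP : InLS P) {A B : X → P} (h : ∀ x y, x < y → A x ≤ B y) :
    ∃ u, ∀ w ≥ u, ∀ x ≥ u, ∃ y ≥ w, ∀ z > y, A x ≤ B z := by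
  obtain ⟨n, r, hlin, hsc, hle⟩ := hP
  obtain ⟨u, hu⟩ := exists_cofinal_boundsAbove_family Finset.univ r hsc B
  refine ⟨u, fun w hw x hx => ?_⟩
  obtain ⟨y, hy, hxy⟩ := hu w hw x hx
  refine ⟨y, hy, fun z hz => (hle _ _).2 fun i => ?_⟩
  exact hxy i (Finset.mem_univ i) (fun t ht => (hle _ _).1 (h x t ht) i) z hz

theorem InLS.exists_le_of_rat {P : Type*} [PartialOrder P] (hP : InLS P) {A B : ℚ → P}
    (h : ∀ x y, x < y → A x ≤ B y) : ∃ x y, y < x ∧ A x ≤ B y := by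
  obtain ⟨n, r, hlin, hsc, hle⟩ := hP
  obtain ⟨u, v, huv, hs⟩ := exists_boundsAbove_eq_family Finset.univ r hsc B
  obtain ⟨y, huy, hyv⟩ := exists_between huv
  refine ⟨v, y, hyv, (hle _ _).2 fun i => ?_⟩
  exact hs i (Finset.mem_univ i) (fun t ht => (hle _ _).1 (h v t ht) i) y huy

theorem InLS.dual {P : Type*} [PartialOrder P] (hP : InLS P) : InLS Pᵒᵈ := by
  obtain ⟨n, r, hlin, hsc, hle⟩ := hP
  refine ⟨n, fun i x y => r i (OrderDual.ofDual y) (OrderDual.ofDual x), fun i => ?_, fun i => ?_,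
    fun x y => hle _ _⟩
  · exact { refl := fun a => refl_of (r i) _
            trans := fun a b c hab hbc => trans_of (r i) hbc hab
            antisymm := fun a b hab hba => antisymm_of (r i) hba hab
            total := fun a b => total_of (r i) _ _ }
  -- A copy of the rationals in the reversed order, precomposed with negation, is one in `r i`.
  · refine ⟨fun e => (hsc i).elim ⟨⟨fun q => OrderDual.ofDual (e (-q)), fun a b hab => ?_⟩, ?_⟩⟩
    · exact neg_injective (e.injective (OrderDual.ofDual.injective hab))
    · intro a b
      exact e.map_rel_iff.trans neg_le_neg_iff

theorem InLS.exists_words {P : Type*} [PartialOrder P] (hP : InLS P) {A B : BinTree → P}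
    (h : ∀ x y, x < y → A x ≤ B y) :
    ∃ (u : BinTree) (s : List Bool), A ⟨u.word ++ [true]⟩ ≤ B ⟨u.word ++ false :: s⟩ := by
  have : Nonempty BinTree := ⟨⟨[]⟩⟩
  obtain ⟨u, hu⟩ := hP.exists_cofinal h
  obtain ⟨y, ⟨s, hs⟩, hy⟩ := hu ⟨u.word ++ [false]⟩ (List.prefix_append _ _)
    ⟨u.word ++ [true]⟩ (List.prefix_append _ _)
  -- The comparability holds only strictly above `y`, so one more letter is appended.
  refine ⟨u, s ++ [false], hy _ (lt_of_le_of_ne ⟨[false], ?_⟩ fun e => ?_)⟩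
  · simp [← hs]
  · simpa [← hs] using congrArg (fun z => z.word.length) e

/-! ### The obstructions do not embed -/

theorem BinTree.not_true_le_false (u s : List Bool) :
    ¬ (⟨u ++ [true]⟩ : BinTree) ≤ ⟨u ++ false :: s⟩ := by
  intro h
  have h' : u ++ [true] <+: u ++ false :: s := h
  simp [List.prefix_append_right_inj] at h'

theorem OmegaEta.not_true_le_false (u s : List Bool) :
    ¬ (⟨u ++ [true]⟩ : OmegaEta) ≤ ⟨u ++ false :: s⟩ := by
  rintro ⟨-, h⟩
  simp only at h
  induction u with
  | nil =>
    rw [List.nil_append, List.nil_append, OmegaEta.cons_le_cons] at h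
    revert h
    simp [Bool.lt_iff]
  | cons b u ih =>
    rw [List.cons_append, List.cons_append, OmegaEta.cons_le_cons] at h
    exact ih (h.resolve_left (lt_irrefl _)).2

theorem OmegaEta.lt_of_lt {x y : BinTree} (h : x < y) : (⟨x.word⟩ : OmegaEta) < ⟨y.word⟩ := by
  refine lt_of_le_of_ne ⟨h.le.length_le, ?_⟩ fun e => h.ne (BinTree.ext (OmegaEta.mk.inj e))
  obtain ⟨t, ht⟩ := h.le
  simp only [← ht]
  exact OmegaEta.lex_append _ _

namespace OpenSplit

variable {Q : Type*} [PartialOrder Q]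

theorem lt_iff {a b : OpenSplit Q} : a < b ↔ a.side < b.side ∧ a.point < b.point := Iff.rfl

theorem zero_lt_one {x y : Q} : (⟨x, 0⟩ : OpenSplit Q) < ⟨y, 1⟩ ↔ x < y := by
  simp [lt_iff]

theorem zero_le_one {x y : Q} : (⟨x, 0⟩ : OpenSplit Q) ≤ ⟨y, 1⟩ ↔ x < y := by
  rw [le_iff_lt_or_eq, zero_lt_one]
  simp

theorem lt_cases {a b : OpenSplit Q} (h : a < b) :
    ∃ x y, a = ⟨x, 0⟩ ∧ b = ⟨y, 1⟩ ∧ x < y := by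
  obtain ⟨x, i⟩ := a
  obtain ⟨y, j⟩ := b
  obtain ⟨h1, h2⟩ := h
  simp only at h1 h2
  refine ⟨x, y, ?_, ?_, h2⟩ <;> congr 1 <;> omega

end OpenSplit

section

variable {P : Type*} [PartialOrder P]

theorem InLS.isEmpty_rat (hP : InLS P) : IsEmpty (ℚ ↪o P) := by
  refine ⟨fun f => ?_⟩
  obtain ⟨x, y, hyx, hxy⟩ := hP.exists_le_of_rat (A := f) (B := f)
    fun x y h => f.le_iff_le.2 h.le
  exact hyx.not_ge (f.le_iff_le.1 hxy)

theorem InLS.isEmpty_openSplit_rat (hP : InLS P) : IsEmpty (OpenSplit ℚ ↪o P) := by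
  refine ⟨fun f => ?_⟩
  obtain ⟨x, y, hyx, hxy⟩ := hP.exists_le_of_rat (A := fun x => f ⟨x, 0⟩) (B := fun x => f ⟨x, 1⟩)
    fun x y h => f.le_iff_le.2 (OpenSplit.zero_le_one.2 h)
  exact hyx.asymm (OpenSplit.zero_le_one.1 (f.le_iff_le.1 hxy))

theorem InLS.isEmpty_binTree (hP : InLS P) : IsEmpty (BinTree ↪o P) := by
  refine ⟨fun f => ?_⟩
  obtain ⟨u, s, h⟩ := hP.exists_words (A := f) (B := f) fun x y h => f.le_iff_le.2 h.le
  exact BinTree.not_true_le_false _ _ (f.le_iff_le.1 h)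

theorem InLS.isEmpty_openSplit_binTree (hP : InLS P) : IsEmpty (OpenSplit BinTree ↪o P) := by
  refine ⟨fun f => ?_⟩
  obtain ⟨u, s, h⟩ := hP.exists_words (A := fun x => f ⟨x, 0⟩) (B := fun x => f ⟨x, 1⟩)
    fun x y h => f.le_iff_le.2 (OpenSplit.zero_le_one.2 h)
  exact BinTree.not_true_le_false _ _ (OpenSplit.zero_le_one.1 (f.le_iff_le.1 h)).le

theorem InLS.isEmpty_omegaEta (hP : InLS P) : IsEmpty (OmegaEta ↪o P) := by
  refine ⟨fun f => ?_⟩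
  obtain ⟨u, s, h⟩ := hP.exists_words (A := fun x => f ⟨x.word⟩) (B := fun x => f ⟨x.word⟩)
    fun x y h => f.le_iff_le.2 (OmegaEta.lt_of_lt h).le
  exact OmegaEta.not_true_le_false _ _ (f.le_iff_le.1 h)

theorem InLS.isEmpty_openSplit_omegaEta (hP : InLS P) : IsEmpty (OpenSplit OmegaEta ↪o P) := by
  refine ⟨fun f => ?_⟩
  obtain ⟨u, s, h⟩ := hP.exists_words (A := fun x => f ⟨⟨x.word⟩, 0⟩)
    (B := fun x => f ⟨⟨x.word⟩, 1⟩)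
    fun x y h => f.le_iff_le.2 (OpenSplit.zero_le_one.2 (OmegaEta.lt_of_lt h))
  exact OmegaEta.not_true_le_false _ _ (OpenSplit.zero_le_one.1 (f.le_iff_le.1 h)).le

theorem isEmpty_dual_embedding {Q : Type*} [PartialOrder Q] (h : IsEmpty (Q ↪o Pᵒᵈ)) :
    IsEmpty (Qᵒᵈ ↪o P) :=
  ⟨fun f => h.elim f.dual⟩

theorem InLS.isEmpty_embeddings (hP : InLS P) :
    IsEmpty (ℚ ↪o P) ∧ IsEmpty (ℚᵒᵈ ↪o P) ∧
      IsEmpty (BinTree ↪o P) ∧ IsEmpty (BinTreeᵒᵈ ↪o P) ∧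
      IsEmpty (OmegaEta ↪o P) ∧ IsEmpty (OmegaEtaᵒᵈ ↪o P) ∧
      IsEmpty (OpenSplit ℚ ↪o P) ∧ IsEmpty ((OpenSplit ℚ)ᵒᵈ ↪o P) ∧
      IsEmpty (OpenSplit BinTree ↪o P) ∧ IsEmpty ((OpenSplit BinTree)ᵒᵈ ↪o P) ∧
      IsEmpty (OpenSplit OmegaEta ↪o P) ∧ IsEmpty ((OpenSplit OmegaEta)ᵒᵈ ↪o P) :=
  ⟨hP.isEmpty_rat, isEmpty_dual_embedding hP.dual.isEmpty_rat,
    hP.isEmpty_binTree, isEmpty_dual_embedding hP.dual.isEmpty_binTree,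
    hP.isEmpty_omegaEta, isEmpty_dual_embedding hP.dual.isEmpty_omegaEta,
    hP.isEmpty_openSplit_rat, isEmpty_dual_embedding hP.dual.isEmpty_openSplit_rat,
    hP.isEmpty_openSplit_binTree, isEmpty_dual_embedding hP.dual.isEmpty_openSplit_binTree,
    hP.isEmpty_openSplit_omegaEta, isEmpty_dual_embedding hP.dual.isEmpty_openSplit_omegaEta⟩

end

/-! ### Self-duality and isomorphism invariants -/

/-- The chain of the rationals is self-dual. -/
def ratDualIso : ℚ ≃o ℚᵒᵈ := OrderIso.neg ℚ

/-- The open split of a self-dual poset is self-dual. -/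
def OpenSplit.dualIso {Q : Type*} [PartialOrder Q] (e : Q ≃o Qᵒᵈ) :
    OpenSplit Q ≃o (OpenSplit Q)ᵒᵈ where
  toFun a := OrderDual.toDual ⟨OrderDual.ofDual (e a.point), a.side.rev⟩
  invFun a := ⟨e.symm (OrderDual.toDual (OrderDual.ofDual a).point), (OrderDual.ofDual a).side.rev⟩
  left_inv a := by simp
  right_inv a := congrArg OrderDual.toDual (OpenSplit.ext (by simp; rfl) (by simp; rfl))
  map_rel_iff' := by
    rintro ⟨x, i⟩ ⟨y, j⟩
    change (_ = _ ∨ _) ↔ (_ = _ ∨ _)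
    refine or_congr ?_ (and_congr Fin.rev_lt_rev e.lt_iff_lt)
    rw [eq_comm (a := (⟨x, i⟩ : OpenSplit Q))]
    exact Equiv.apply_eq_iff_eq _

/-- There is a chain of three elements. -/
def HasChainThree (Q : Type*) [PartialOrder Q] : Prop := ∃ a b c : Q, a < b ∧ b < c

/-- Some element lies strictly below every nonminimal element. -/
def HasRoot (Q : Type*) [PartialOrder Q] : Prop := ∃ a : Q, ∀ c, (∃ b, b < c) → a < c

/-- Any two nonmaximal elements have a common strict upper bound. -/
def IsUpDirected (Q : Type*) [PartialOrder Q] : Prop :=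
  ∀ a b : Q, (∃ c, a < c) → (∃ c, b < c) → ∃ c, a < c ∧ b < c

section

variable {Q : Type*} [PartialOrder Q]

theorem HasChainThree.map {R : Type*} [PartialOrder R] (e : Q ≃o R) (h : HasChainThree Q) :
    HasChainThree R := by
  obtain ⟨a, b, c, h1, h2⟩ := h
  exact ⟨e a, e b, e c, e.lt_iff_lt.2 h1, e.lt_iff_lt.2 h2⟩

theorem HasRoot.map {R : Type*} [PartialOrder R] (e : Q ≃o R) (h : HasRoot Q) : HasRoot R := by
  obtain ⟨a, ha⟩ := h
  refine ⟨e a, fun c ⟨b, hb⟩ => e.lt_symm_apply.1 (ha _ ⟨e.symm b, e.symm.lt_iff_lt.2 hb⟩)⟩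

theorem IsUpDirected.map {R : Type*} [PartialOrder R] (e : Q ≃o R) (h : IsUpDirected Q) :
    IsUpDirected R := by
  rintro a b ⟨c, hc⟩ ⟨d, hd⟩
  obtain ⟨z, hz, hz'⟩ := h (e.symm a) (e.symm b) ⟨e.symm c, e.symm.lt_iff_lt.2 hc⟩
    ⟨e.symm d, e.symm.lt_iff_lt.2 hd⟩
  exact ⟨e z, e.symm_apply_lt.1 hz, e.symm_apply_lt.1 hz'⟩

theorem hasChainThree_of_noMaxOrder [Nonempty Q] [NoMaxOrder Q] : HasChainThree Q := by
  obtain ⟨a⟩ := ‹Nonempty Q›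
  obtain ⟨b, hb⟩ := exists_gt a
  obtain ⟨c, hc⟩ := exists_gt b
  exact ⟨a, b, c, hb, hc⟩

theorem HasChainThree.dual (h : HasChainThree Q) : HasChainThree Qᵒᵈ := by
  obtain ⟨a, b, c, h1, h2⟩ := h
  exact ⟨OrderDual.toDual c, OrderDual.toDual b, OrderDual.toDual a, h2, h1⟩

theorem OpenSplit.not_hasChainThree : ¬ HasChainThree (OpenSplit Q) := by
  rintro ⟨a, b, c, h1, h2⟩
  obtain ⟨_, _, -, rfl, -⟩ := OpenSplit.lt_cases h1
  obtain ⟨_, _, h, -, -⟩ := OpenSplit.lt_cases h2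
  simp at h

theorem hasRoot_of_orderBot [OrderBot Q] : HasRoot Q :=
  ⟨⊥, fun _ ⟨_, hb⟩ => bot_le.trans_lt hb⟩

theorem OpenSplit.hasRoot_of_orderBot [OrderBot Q] : HasRoot (OpenSplit Q) := by
  refine ⟨⟨⊥, 0⟩, fun c ⟨b, hb⟩ => ?_⟩
  obtain ⟨x, y, rfl, rfl, h⟩ := OpenSplit.lt_cases hb
  exact OpenSplit.zero_lt_one.2 (bot_le.trans_lt h)

theorem not_hasRoot_dual_of_noMaxOrder [NoMaxOrder Q] : ¬ HasRoot Qᵒᵈ := by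
  rintro ⟨a, ha⟩
  obtain ⟨b, hb⟩ := exists_gt (OrderDual.ofDual a)
  exact lt_irrefl _ (ha a ⟨OrderDual.toDual b, hb⟩)

theorem OpenSplit.not_hasRoot_dual_of_noMaxOrder [NoMaxOrder Q] :
    ¬ HasRoot (OpenSplit Q)ᵒᵈ := by
  rintro ⟨a, ha⟩
  have key (x : Q) : (⟨x, 0⟩ : OpenSplit Q) < OrderDual.ofDual a := by
    obtain ⟨y, hy⟩ := exists_gt x
    exact ha (OrderDual.toDual ⟨x, 0⟩) ⟨OrderDual.toDual ⟨y, 1⟩, OpenSplit.zero_lt_one.2 hy⟩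
  -- Applied to the lower copy of the root's own point, `key` puts that point strictly below itself.
  exact lt_irrefl _ (key (OrderDual.ofDual a).point).2

theorem IsUpDirected.openSplit (h : IsUpDirected Q) : IsUpDirected (OpenSplit Q) := by
  rintro a b ⟨c, hc⟩ ⟨d, hd⟩
  obtain ⟨x, y, rfl, rfl, h1⟩ := OpenSplit.lt_cases hc
  obtain ⟨x', y', rfl, rfl, h2⟩ := OpenSplit.lt_cases hd
  obtain ⟨z, hz, hz'⟩ := h x x' ⟨y, h1⟩ ⟨y', h2⟩
  exact ⟨⟨z, 1⟩, OpenSplit.zero_lt_one.2 hz, OpenSplit.zero_lt_one.2 hz'⟩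

theorem IsUpDirected.of_openSplit (h : IsUpDirected (OpenSplit Q)) : IsUpDirected Q := by
  rintro a b ⟨c, hc⟩ ⟨d, hd⟩
  obtain ⟨z, hz, hz'⟩ := h ⟨a, 0⟩ ⟨b, 0⟩ ⟨⟨c, 1⟩, OpenSplit.zero_lt_one.2 hc⟩
    ⟨⟨d, 1⟩, OpenSplit.zero_lt_one.2 hd⟩
  exact ⟨z.point, hz.2, hz'.2⟩

theorem HasRoot.isUpDirected_dual (h : HasRoot Q) : IsUpDirected Qᵒᵈ := by
  obtain ⟨r, hr⟩ := h
  exact fun a b ⟨c, hc⟩ ⟨d, hd⟩ => ⟨OrderDual.toDual r, hr _ ⟨_, hc⟩, hr _ ⟨_, hd⟩⟩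

/-- Directedness of nonmaximal elements upwards and of nonminimal elements downwards. -/
def IsBidirected (Q : Type*) [PartialOrder Q] : Prop := IsUpDirected Q ∧ IsUpDirected Qᵒᵈ

/-- Four isomorphism-invariant properties that distinguish the ten obstructions. -/
def invariants (Q : Type*) [PartialOrder Q] : Prop × Prop × Prop × Prop :=
  (HasChainThree Q, HasRoot Q, HasRoot Qᵒᵈ, IsBidirected Q)

theorem invariants_congr {R : Type*} [PartialOrder R] (e : Q ≃o R) :
    invariants Q = invariants R := by
  simp only [invariants, IsBidirected, Prod.mk.injEq, eq_iff_iff]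
  exact ⟨⟨.map e, .map e.symm⟩, ⟨.map e, .map e.symm⟩, ⟨.map e.dual, .map e.symm.dual⟩,
    and_congr ⟨.map e, .map e.symm⟩ ⟨.map e.dual, .map e.symm.dual⟩⟩

theorem invariants_dual {a b c d : Prop} (h : invariants Q = (a, b, c, d)) :
    invariants Qᵒᵈ = (a, c, b, d) := by
  simp only [invariants, IsBidirected, Prod.mk.injEq, eq_iff_iff] at h ⊢
  obtain ⟨h1, h2, h3, h4⟩ := h
  exact ⟨⟨fun h => h1.1 h.dual, fun h => (h1.2 h).dual⟩, h3, h2, and_comm.trans h4⟩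

/-- A least element makes downward directedness automatic, so the last invariant reduces to upward
directedness, which separates Ω(η) from T₂. -/
theorem invariants_of_orderBot [OrderBot Q] [NoMaxOrder Q] :
    invariants Q = (True, True, False, IsUpDirected Q) := by
  simp only [invariants, Prod.mk.injEq, eq_iff_iff, iff_true, iff_false]
  exact ⟨hasChainThree_of_noMaxOrder, hasRoot_of_orderBot, not_hasRoot_dual_of_noMaxOrder,
    and_iff_left hasRoot_of_orderBot.isUpDirected_dual⟩

theorem invariants_openSplit_of_orderBot [OrderBot Q] [NoMaxOrder Q] :
    invariants (OpenSplit Q) = (False, True, False, IsUpDirected Q) := by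
  simp only [invariants, Prod.mk.injEq, eq_iff_iff, iff_true, iff_false]
  exact ⟨OpenSplit.not_hasChainThree, OpenSplit.hasRoot_of_orderBot,
    OpenSplit.not_hasRoot_dual_of_noMaxOrder,
    (and_iff_left OpenSplit.hasRoot_of_orderBot.isUpDirected_dual).trans
      ⟨.of_openSplit, .openSplit⟩⟩

end

/-! ### Values of the invariants on the ten obstructions -/

theorem isUpDirected_rat : IsUpDirected ℚ := by
  rintro a b - -
  obtain ⟨c, hc⟩ := exists_gt (max a b)
  exact ⟨c, max_lt_iff.1 hc⟩

theorem invariants_rat : invariants ℚ = (True, False, False, True) := by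
  have h : ¬ HasRoot ℚᵒᵈ := not_hasRoot_dual_of_noMaxOrder
  simp only [invariants, Prod.mk.injEq, eq_iff_iff, iff_true, iff_false]
  exact ⟨hasChainThree_of_noMaxOrder, fun h' => h (h'.map ratDualIso), h,
    isUpDirected_rat, isUpDirected_rat.map ratDualIso⟩

theorem invariants_openSplit_rat : invariants (OpenSplit ℚ) = (False, False, False, True) := by
  have h : ¬ HasRoot (OpenSplit ℚ)ᵒᵈ := OpenSplit.not_hasRoot_dual_of_noMaxOrder
  have e := OpenSplit.dualIso ratDualIso
  simp only [invariants, Prod.mk.injEq, eq_iff_iff, iff_true, iff_false]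
  exact ⟨OpenSplit.not_hasChainThree, fun h' => h (h'.map e), h,
    isUpDirected_rat.openSplit, isUpDirected_rat.openSplit.map e⟩

instance : OrderBot BinTree where
  bot := ⟨[]⟩
  bot_le _ := List.nil_prefix

theorem BinTree.lt_append (u : List Bool) (b : Bool) : (⟨u⟩ : BinTree) < ⟨u ++ [b]⟩ :=
  lt_of_le_of_ne (List.prefix_append _ _) fun e => by simpa using congrArg BinTree.word e

instance : NoMaxOrder BinTree := ⟨fun u => ⟨_, BinTree.lt_append u.word false⟩⟩

theorem BinTree.not_isUpDirected : ¬ IsUpDirected BinTree := by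
  intro h
  obtain ⟨⟨w⟩, h0, h1⟩ := h ⟨[false]⟩ ⟨[true]⟩ (exists_gt _) (exists_gt _)
  obtain ⟨s, hs⟩ := h0.le
  obtain rfl : [false] ++ s = w := hs
  exact BinTree.not_true_le_false [] s h1.le

instance : OrderBot OmegaEta where
  bot := ⟨[]⟩
  bot_le u := ⟨Nat.zero_le _, OmegaEta.lex_append [] u.word⟩

instance : NoMaxOrder OmegaEta :=
  ⟨fun u => ⟨_, OmegaEta.lt_of_lt (BinTree.lt_append u.word false)⟩⟩

/-- The rightmost word of a level dominates that level and all earlier ones; this makes Ω(η)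
directed. -/
theorem OmegaEta.le_replicate_true (s : List Bool) (n : ℕ) (h : s.length ≤ n) :
    (⟨s⟩ : OmegaEta) ≤ ⟨List.replicate n true⟩ := by
  refine ⟨by simpa using h, ?_⟩
  simp only
  induction s generalizing n with
  | nil => exact OmegaEta.lex_append [] _
  | cons b s ih =>
    obtain _ | n := n
    · simp at h
    · rw [List.replicate_succ, OmegaEta.cons_le_cons]
      cases b
      · exact Or.inl Bool.false_lt_true
      · exact Or.inr ⟨rfl, ih n (by simpa using h)⟩

theorem OmegaEta.isUpDirected : IsUpDirected OmegaEta := by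
  rintro a b - -
  obtain ⟨c, hc⟩ := exists_gt
    (⟨List.replicate (max a.word.length b.word.length) true⟩ : OmegaEta)
  exact ⟨c, (OmegaEta.le_replicate_true a.word _ (le_max_left _ _)).trans_lt hc,
    (OmegaEta.le_replicate_true b.word _ (le_max_right _ _)).trans_lt hc⟩

theorem invariants_binTree : invariants BinTree = (True, True, False, False) := by
  rw [invariants_of_orderBot, eq_false BinTree.not_isUpDirected]

theorem invariants_omegaEta : invariants OmegaEta = (True, True, False, True) := by
  rw [invariants_of_orderBot, eq_true OmegaEta.isUpDirected]

theorem invariants_openSplit_binTree :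
    invariants (OpenSplit BinTree) = (False, True, False, False) := by
  rw [invariants_openSplit_of_orderBot, eq_false BinTree.not_isUpDirected]

theorem invariants_openSplit_omegaEta :
    invariants (OpenSplit OmegaEta) = (False, True, False, True) := by
  rw [invariants_openSplit_of_orderBot, eq_true OmegaEta.isUpDirected]

/-- The truth values of the four invariants on the ten obstructions. -/
def invariantCode : Fin 10 → Bool × Bool × Bool × Bool :=
  ![(true, false, false, true), (true, true, false, false), (true, true, false, true),
    (false, false, false, true), (false, true, false, false), (false, true, false, true),
    (true, false, true, false), (true, false, true, true),
    (false, false, true, false), (false, false, true, true)]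

theorem invariants_obstruction (k : Fin 10) :
    invariants (obstruction k) = ((invariantCode k).1 = true, (invariantCode k).2.1 = true,
      (invariantCode k).2.2.1 = true, (invariantCode k).2.2.2 = true) := by
  fin_cases k
  · exact invariants_rat.trans (by simp [invariantCode])
  · exact invariants_binTree.trans (by simp [invariantCode])
  · exact invariants_omegaEta.trans (by simp [invariantCode])
  · exact invariants_openSplit_rat.trans (by simp [invariantCode])
  · exact invariants_openSplit_binTree.trans (by simp [invariantCode])
  · exact invariants_openSplit_omegaEta.trans (by simp [invariantCode])
  · exact (invariants_dual invariants_binTree).trans (by simp [invariantCode])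
  · exact (invariants_dual invariants_omegaEta).trans (by simp [invariantCode])
  · exact (invariants_dual invariants_openSplit_binTree).trans (by simp [invariantCode])
  · exact (invariants_dual invariants_openSplit_omegaEta).trans (by simp [invariantCode])

theorem invariantCode_injective : Function.Injective invariantCode := by
  decide

theorem isEmpty_obstruction_iso {k l : Fin 10} (hkl : k ≠ l) :
    IsEmpty (obstruction k ≃o obstruction l) := by
  refine ⟨fun e => hkl (invariantCode_injective ?_)⟩
  have h := invariants_congr e
  rw [invariants_obstruction, invariants_obstruction] at h
  simp only [Prod.mk.injEq, eq_iff_iff, ← Bool.eq_iff_iff] at h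
  obtain ⟨h1, h2, h3, h4⟩ := h
  exact Prod.ext h1 (Prod.ext h2 (Prod.ext h3 h4))

theorem obstruction_not_inLS (k : Fin 10) : ¬ InLS (obstruction k) := by
  intro h
  obtain ⟨h0, -, h1, h6, h2, h7, h3, -, h4, h8, h5, h9⟩ := h.isEmpty_embeddings
  fin_cases k
  · exact h0.elim (OrderIso.refl ℚ).toOrderEmbedding
  · exact h1.elim (OrderIso.refl BinTree).toOrderEmbedding
  · exact h2.elim (OrderIso.refl OmegaEta).toOrderEmbedding
  · exact h3.elim (OrderIso.refl (OpenSplit ℚ)).toOrderEmbedding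
  · exact h4.elim (OrderIso.refl (OpenSplit BinTree)).toOrderEmbedding
  · exact h5.elim (OrderIso.refl (OpenSplit OmegaEta)).toOrderEmbedding
  · exact h6.elim (OrderIso.refl BinTreeᵒᵈ).toOrderEmbedding
  · exact h7.elim (OrderIso.refl OmegaEtaᵒᵈ).toOrderEmbedding
  · exact h8.elim (OrderIso.refl (OpenSplit BinTree)ᵒᵈ).toOrderEmbedding
  · exact h9.elim (OrderIso.refl (OpenSplit OmegaEta)ᵒᵈ).toOrderEmbedding

theorem theorem1 :
    (∀ (P : Type*) [PartialOrder P], InLS P →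
      IsEmpty (ℚ ↪o P) ∧ IsEmpty (ℚᵒᵈ ↪o P) ∧
      IsEmpty (BinTree ↪o P) ∧ IsEmpty (BinTreeᵒᵈ ↪o P) ∧
      IsEmpty (OmegaEta ↪o P) ∧ IsEmpty (OmegaEtaᵒᵈ ↪o P) ∧
      IsEmpty (OpenSplit ℚ ↪o P) ∧ IsEmpty ((OpenSplit ℚ)ᵒᵈ ↪o P) ∧
      IsEmpty (OpenSplit BinTree ↪o P) ∧ IsEmpty ((OpenSplit BinTree)ᵒᵈ ↪o P) ∧
      IsEmpty (OpenSplit OmegaEta ↪o P) ∧ IsEmpty ((OpenSplit OmegaEta)ᵒᵈ ↪o P)) ∧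
    Nonempty (ℚ ≃o ℚᵒᵈ) ∧ Nonempty (OpenSplit ℚ ≃o (OpenSplit ℚ)ᵒᵈ) ∧
    (∀ k : Fin 10, ¬ InLS (obstruction k)) ∧
    (∀ k l : Fin 10, k ≠ l → IsEmpty (obstruction k ≃o obstruction l)) := by
  exact ⟨fun P _ hP => hP.isEmpty_embeddings, ⟨ratDualIso⟩, ⟨OpenSplit.dualIso ratDualIso⟩,
    obstruction_not_inLS, fun _ _ => isEmpty_obstruction_iso⟩
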